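/- Theorem 3. An ascending wave with $k$ terms is a sequence of positive integers $w_1<w_2<\dots<w_k$ with $w_{i+1}-w_i\ge w_i-w_{i-1}$ for $2\le i\le k-1$. For integers $k,r\ge 1$ let $AW(k;r)$ be the least positive integer $N$ such that every $r$-coloring of $[1,N]=\{1,2,\dots,N\}$ admits a monochromatic $k$-term ascending wave. Then $AW(k;3)$ exists for every $k\ge 1$, and $$\frac{k^5}{2^{13}\cdot 10^{39}}\le AW(k;3)\le \frac{k^5}{120}\,(1+o(1)),$$ where the lower bound holds for every integer $k\ge 1$ and $o(1)$ denotes a function of $k$ that tends to $0$ as $k\to\infty$. In particular $AW(k;3)=\Theta(k^5)$ as $k\to\infty$. -/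

import Mathlib

open Filter Topology Asymptotics

/-- An ascending wave with `k` terms `w 0 < w 1 < ⋯ < w (k - 1)`: a strictly increasing sequence of
positive integers whose consecutive differences are non-decreasing. -/
def IsAscendingWave {k : ℕ} (w : Fin k → ℕ) : Prop :=
  (∀ i, 0 < w i) ∧ StrictMono w ∧
    ∀ (i : ℕ) (h : i + 2 < k),
      (w ⟨i + 1, by omega⟩ : ℤ) - (w ⟨i, by omega⟩ : ℤ) ≤
        (w ⟨i + 2, h⟩ : ℤ) - (w ⟨i + 1, by omega⟩ : ℤ)

/-- Every coloring of `[1, N]` with `r` colors admits a monochromatic `k`-term ascending wave. -/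
def ForcesWave (k r N : ℕ) : Prop :=
  ∀ χ : Finset.Icc 1 N → Fin r,
    ∃ w : Fin k → Finset.Icc 1 N,
      IsAscendingWave (fun i => (w i : ℕ)) ∧ ∃ c : Fin r, ∀ i, χ (w i) = c

/-- `AW k r` is the least positive integer `N` such that every `r`-coloring of `[1, N]` admits a
monochromatic `k`-term ascending wave. -/
noncomputable def AW (k r : ℕ) : ℕ :=
  sInf {N : ℕ | 0 < N ∧ ForcesWave k r N}

/-!
The upper bound is a double induction. Suppose that a colouring with `r` colours has a monochromatic
`k`-term wave of colour `c` with last difference at most `D`. If `c` recurs in the interval of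
length `N'` that starts `D` after the end of the wave, the wave extends to `k + 1` terms with last
difference less than `D + N'`; otherwise that interval uses one colour less and by induction
contains a `(k + 1)`-term wave if `N'` is large enough. The resulting recursions for the length and
the last difference are solved by binomial coefficients (`exists_wave_of_card_le`), and give
`AW k 3 ≤ C(k + 4, 5)`.

The lower bound is a probabilistic construction which adds one colour at a time
(`exists_avoids_succ`). Take a colouring `η` of an interval of length `B` by `r` colours without
long waves, and cut a longer interval into blocks of length `B`, each coloured by a copy of `η` that
leaves out one of `r + 1` colours. The left out colours are given by superblocks of `18` blocks. In
one third of a superblock, the first or the last, they run through all colours, and in the other two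
thirds they are constant. The position of the special third and the constant are chosen at random.

A monochromatic wave must leave each block after few terms, and must jump over a block that lacks
its colour within two superblocks, so after few terms its differences exceed `B`
(`exists_lt_diff`). Since half of the terms come later, the differences stay below a bound that is
small compared with `B` times the number of terms (`exists_isTrack`). Hence the monotone sequence
of differences is nearly constant most of the time, and the wave is described by a code with a small
number of bits that predicts most of its terms up to an error of two blocks (`IsTrack.close`). A
prediction of this kind fixes at most two superblocks, and with probability bounded below all
blocks near the predicted position lack the colour of the wave. As the predictions involve disjoint
sets of superblocks, these events are independent, so a code belongs to a monochromatic wave with a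
probability that is exponentially small (`card_avoiding_mul_le`, `card_fiber_mul_le`) and outweighs
the number of codes. Each step multiplies the length by the square of the number of terms, up to a
constant; starting from one colour, two steps give a length of order `k ^ 5`.
-/

/-! ### Waves as convex sequences -/

/-- A `k`-term ascending wave (without the positivity requirement), given by the first `k` values
of a sequence `w : ℕ → ℕ`; the later values are irrelevant. -/
structure IsWave (k : ℕ) (w : ℕ → ℕ) : Prop where
  lt : ∀ i, i + 1 < k → w i < w (i + 1)
  convex : ∀ i, i + 2 < k → 2 * w (i + 1) ≤ w i + w (i + 2)

namespace IsWave

variable {k : ℕ} {w : ℕ → ℕ}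

lemma lt_of_lt (h : IsWave k w) {i j : ℕ} (hij : i < j) (hj : j < k) : w i < w j := by
  induction j, hij using Nat.le_induction with
  | base => exact h.lt i hj
  | succ j hij ih => exact (ih (by omega)).trans (h.lt j hj)

lemma le_of_le (h : IsWave k w) {i j : ℕ} (hij : i ≤ j) (hj : j < k) : w i ≤ w j := by
  rcases hij.eq_or_lt with rfl | hlt
  · exact le_rfl
  · exact (h.lt_of_lt hlt hj).le

/-- The consecutive differences of a wave are monotone. -/
lemma diff_mono (h : IsWave k w) {i j : ℕ} (hij : i ≤ j) (hj : j + 1 < k) :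
    (w (i + 1) : ℤ) - w i ≤ w (j + 1) - w j := by
  induction j, hij using Nat.le_induction with
  | base => exact le_rfl
  | succ j hij ih =>
    have h1 := ih (by omega)
    have h2 := h.convex j hj
    rw [show j + 1 + 1 = j + 2 from rfl]
    omega

lemma mul_diff_le (h : IsWave k w) {i j : ℕ} (t : ℕ) (hij : i ≤ j)
    (hj : j + t < k) : (t : ℤ) * (w (i + 1) - w i) ≤ w (j + t) - w j := by
  induction t with
  | zero => simp
  | succ t ih =>
    have h1 := ih (by omega)
    have h2 := h.diff_mono (i := i) (j := j + t) (by omega) (by omega)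
    rw [show j + (t + 1) = j + t + 1 by omega]
    push_cast
    linarith

lemma le_mul_diff (h : IsWave k w) {j l : ℕ} (t : ℕ) (hl : l + 1 < k) (hj : j + t ≤ l + 1) :
    (w (j + t) : ℤ) - w j ≤ t * (w (l + 1) - w l) := by
  induction t with
  | zero => simp
  | succ t ih =>
    have h1 := ih (by omega)
    have h2 := h.diff_mono (i := j + t) (j := l) (by omega) (by omega)
    rw [show j + (t + 1) = j + t + 1 by omega]
    push_cast
    linarith

/-- Increments over a fixed lag are monotone. -/
lemma lag_mono (h : IsWave k w) {i j : ℕ} (t : ℕ) (hij : i ≤ j) (hj : j + t < k) :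
    (w (i + t) : ℤ) - w i ≤ w (j + t) - w j := by
  induction t with
  | zero => simp
  | succ t ih =>
    have h1 := ih (by omega)
    have h2 := h.diff_mono (i := i + t) (j := j + t) (by omega) (by omega)
    rw [show j + (t + 1) = j + t + 1 by omega, show i + (t + 1) = i + t + 1 by omega]
    linarith

/-- Regularly spaced terms of a wave form a wave. -/
lemma subsample (h : IsWave k w) {a q l : ℕ} (hq : 0 < q) (hl : a + q * l < k + q) :
    IsWave l (fun i => w (a + q * i)) := by
  constructor
  · intro i hi
    have : q * (i + 2) ≤ q * l := Nat.mul_le_mul_left _ hi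
    apply h.lt_of_lt <;> nlinarith
  · intro i hi
    have h0 : q * (i + 3) ≤ q * l := Nat.mul_le_mul_left _ hi
    have h1 := h.lag_mono (i := a + q * i) (j := a + q * (i + 1)) q (by nlinarith) (by nlinarith)
    rw [show a + q * i + q = a + q * (i + 1) by ring,
      show a + q * (i + 1) + q = a + q * (i + 2) by ring] at h1
    show 2 * w (a + q * (i + 1)) ≤ w (a + q * i) + w (a + q * (i + 2))
    omega

/-- A wave lies below its chords. -/
lemma le_chord (h : IsWave k w) {a s i : ℕ} (his : i < s) (hs : a + s < k) :
    (s : ℤ) * (w (a + i) - w a) ≤ i * (w (a + s) - w a) := by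
  have h1 := h.le_mul_diff (j := a) (l := a + i) i (by omega) (by omega)
  have h2 := h.mul_diff_le (i := a + i) (j := a + i) (s - i) le_rfl (by omega)
  rw [show a + i + (s - i) = a + s by omega] at h2
  push_cast [his.le] at h2
  have hi : (0 : ℤ) ≤ i := by positivity
  have hsi : (0 : ℤ) ≤ (s : ℤ) - i := by have : (i : ℤ) < s := by exact_mod_cast his
                                         linarith
  nlinarith [mul_le_mul_of_nonneg_left h1 hsi, mul_le_mul_of_nonneg_left h2 hi]

/-- A wave lies above the continuation of its earlier chords. -/
lemma chord_le (h : IsWave k w) {a b s i : ℕ} (hb : b + s = a) (his : i < s) (hs : a + s < k) :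
    (i : ℤ) * (w a - w b) ≤ s * (w (a + i) - w a) := by
  have h1 := h.le_mul_diff (j := b) (l := a) s (by omega) (by omega)
  have h2 := h.mul_diff_le (i := a) (j := a) i le_rfl (by omega)
  rw [hb] at h1
  have hi : (0 : ℤ) ≤ i := by positivity
  have hs : (0 : ℤ) ≤ s := by positivity
  nlinarith [mul_le_mul_of_nonneg_left h1 hi, mul_le_mul_of_nonneg_left h2 hs]

lemma mono_length (h : IsWave k w) {l : ℕ} (hl : l ≤ k) : IsWave l w :=
  ⟨fun i hi => h.lt i (by omega), fun i hi => h.convex i (by omega)⟩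

/-- A wave may be continued by any term whose distance from the last one is at least some bound
for the last difference. For a single term, `k = 0`, the truncated `w k - w (k - 1)` is `0`. -/
lemma snoc (h : IsWave (k + 1) w) {x D : ℕ} (hD : 0 < D) (hw : w k - w (k - 1) ≤ D)
    (hx : w k + D ≤ x) : IsWave (k + 2) (fun i => if i ≤ k then w i else x) := by
  constructor
  · intro i hi
    rcases Nat.lt_or_ge i k with hik | hik
    · simpa [hik.le, Nat.succ_le_of_lt hik] using h.lt i (by omega)
    · obtain rfl : i = k := by omega
      simp; omega
  · intro i hi
    rcases Nat.lt_or_ge (i + 1) k with hik | hik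
    · simpa [show i ≤ k by omega, hik.le, Nat.succ_le_of_lt hik] using h.convex i (by omega)
    · obtain rfl : k = i + 1 := by omega
      simp only [Nat.add_sub_cancel] at hw
      simp; omega

end IsWave

/-! ### Colourings without long waves -/

/-- The colouring `χ` of `[0, N)` has no monochromatic `k`-term wave. -/
def Avoids {r : ℕ} (k N : ℕ) (χ : ℕ → Fin r) : Prop :=
  ∀ w, IsWave k w → (∀ i < k, w i < N) → ∀ c, ∃ i < k, χ (w i) ≠ c

lemma Avoids.mono {r k l N : ℕ} {χ : ℕ → Fin r} (h : Avoids k N χ) (hkl : k ≤ l) :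
    Avoids l N χ := fun w hw hN c =>
  let ⟨i, hi, hc⟩ := h w (hw.mono_length hkl) (fun i hi => hN i (by omega)) c
  ⟨i, by omega, hc⟩

lemma avoids_of_lt {r k N : ℕ} (χ : ℕ → Fin r) (h : N < k) : Avoids k N χ := by
  intro w hw hN c
  exfalso
  have key : ∀ i, i < k → i ≤ w i := by
    intro i
    induction i with
    | zero => simp
    | succ i ih => intro hi; have := ih (by omega); have := hw.lt i hi; omega
  have := key N h
  have := hN N h
  omega

/-- `Avoids` colours `[0, N)` and `ForcesWave` colours `[1, N]`; the two differ by a shift. -/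
lemma Avoids.not_forcesWave {k r N : ℕ} {χ : ℕ → Fin r} (h : Avoids k N χ) : ¬ ForcesWave k r N := by
  intro hF
  obtain ⟨w, ⟨-, hlt, hconv⟩, c, hc⟩ := hF (fun x => χ ((x : ℕ) - 1))
  have hw1 : ∀ i, 1 ≤ (w i : ℕ) ∧ (w i : ℕ) ≤ N := fun i => Finset.mem_Icc.1 (w i).2
  obtain ⟨i, hi, hne⟩ := h (fun i => if h : i < k then (w ⟨i, h⟩ : ℕ) - 1 else 0)
    ⟨fun i hi => by
      have h1 : (w ⟨i, by omega⟩ : ℕ) < w ⟨i + 1, hi⟩ := hlt (by simp [Fin.lt_def])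
      have h2 := hw1 ⟨i, by omega⟩
      simp only [hi, show i < k by omega, dif_pos]; omega,
    fun i hi => by
      have h1 := hconv i hi
      dsimp only at h1
      have h2 := hw1 ⟨i, by omega⟩
      have h3 := hw1 ⟨i + 1, by omega⟩
      have h4 := hw1 ⟨i + 2, by omega⟩
      simp only [hi, show i < k by omega, show i + 1 < k by omega, dif_pos]; omega⟩
    (fun i hi => by have := hw1 ⟨i, hi⟩; simp only [hi, dif_pos]; omega) c
  simp only [hi, dif_pos] at hne
  exact hne (hc ⟨i, hi⟩)

/-! ### The upper bound -/

/-- Any colouring of an interval of length `C(k + 2ρ + 1, 2ρ + 1)` with at most `ρ + 1` colours has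
a monochromatic `(k + 1)`-term wave, whose last difference can moreover be bounded. Controlling the
last difference is what drives the induction: past the end of a `k`-term wave of colour `c`, either
`c` reappears soon, which continues the wave, or there is a long interval without the colour `c`. -/
lemma exists_wave_of_card_le {C : Type*} [DecidableEq C] (χ : ℕ → C) (ρ : ℕ) : ∀ (k a : ℕ)
    (S : Finset C), S.card ≤ ρ + 1 →
    (∀ x, a ≤ x → x < a + (k + 2 * ρ + 1).choose (2 * ρ + 1) → χ x ∈ S) →
    ∃ w : ℕ → ℕ, ∃ c, IsWave (k + 1) w ∧
      (∀ i < k + 1, a ≤ w i ∧ w i < a + (k + 2 * ρ + 1).choose (2 * ρ + 1) ∧ χ (w i) = c) ∧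
      w k - w (k - 1) ≤ (k + 2 * ρ).choose (2 * ρ) := by
  induction ρ with
  | zero =>
    intro k a S hS hχ
    simp only [mul_zero, add_zero, zero_add, Nat.choose_one_right, Nat.choose_zero_right] at *
    refine ⟨fun i => a + i, χ a, ⟨fun i _ => by simp, fun i _ => by omega⟩,
      fun i hi => ⟨by simp, show a + i < _ by omega, ?_⟩, show a + k - (a + (k - 1)) ≤ 1 by omega⟩
    exact Finset.card_le_one.1 hS _ (hχ _ (Nat.le_add_right a i) (by omega)) _
      (hχ _ le_rfl (by omega))
  | succ ρ ih =>
    intro k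
    induction k with
    | zero =>
      intro a S _ _
      refine ⟨fun _ => a, χ a, ⟨fun i hi => by omega, fun i hi => by omega⟩, fun i hi => ?_, ?_⟩
      · simp
      · simp
    | succ k ihk =>
      intro a S hS hχ
      set N := (k + 2 * (ρ + 1) + 1).choose (2 * (ρ + 1) + 1) with hN
      set D := (k + 2 * (ρ + 1)).choose (2 * (ρ + 1)) with hD
      set N' := (k + 1 + 2 * ρ + 1).choose (2 * ρ + 1) with hN'
      have hD0 : 0 < D := Nat.choose_pos (by omega)
      have hDD : (k + 1 + 2 * (ρ + 1)).choose (2 * (ρ + 1)) = D + N' := by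
        rw [show k + 1 + 2 * (ρ + 1) = k + 1 + 2 * ρ + 1 + 1 by ring,
          show 2 * (ρ + 1) = 2 * ρ + 1 + 1 by ring, Nat.choose_succ_succ, hD, hN']
        rw [show 2 * (ρ + 1) = 2 * ρ + 1 + 1 by ring,
          show k + (2 * ρ + 1 + 1) = k + 1 + 2 * ρ + 1 by ring, add_comm]
      have hNN : (k + 1 + 2 * (ρ + 1) + 1).choose (2 * (ρ + 1) + 1) = N + (D + N') := by
        rw [Nat.choose_succ_succ, hDD, add_comm, hN]
        rw [show k + 1 + 2 * (ρ + 1) = k + 2 * (ρ + 1) + 1 by ring]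
      have hD' : (k + 1 + 2 * ρ).choose (2 * ρ) ≤ N' := by
        rw [hN', Nat.choose_succ_succ]; omega
      rw [hNN] at hχ ⊢
      rw [hDD]
      obtain ⟨w, c, hw, hwc, hlast⟩ := ihk a S hS (fun x h1 h2 => hχ x h1 (by omega))
      by_cases hex : ∃ x, w k + D ≤ x ∧ x < w k + D + N' ∧ χ x = c
      · obtain ⟨x, hx1, hx2, hxc⟩ := hex
        refine ⟨_, c, hw.snoc hD0 hlast hx1, fun i hi => ?_, ?_⟩
        · have hk := hwc k (by omega)
          by_cases hik : i ≤ k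
          · have := hwc i (by omega)
            simp only [hik, if_true]
            exact ⟨this.1, by omega, this.2.2⟩
          · simp only [hik, if_false]
            exact ⟨by omega, by omega, hxc⟩
        · simp; omega
      · push Not at hex
        have hk := hwc k (by omega)
        have hcS : c ∈ S := hk.2.2 ▸ hχ _ hk.1 (by omega)
        obtain ⟨v, e, hv, hve, hvl⟩ := ih (k + 1) (w k + D) (S.erase c)
          (by rw [Finset.card_erase_of_mem hcS]; omega)
          (fun x h1 h2 => Finset.mem_erase.2 ⟨hex x h1 h2, hχ x (by omega) (by omega)⟩)
        refine ⟨v, e, hv, fun i hi => ?_, by omega⟩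
        have := hve i hi
        exact ⟨by omega, by omega, this.2.2⟩

lemma forcesWave_choose (k : ℕ) : ForcesWave (k + 1) 3 ((k + 5).choose 5) := by
  intro χ
  have hpos : 0 < (k + 5).choose 5 := Nat.choose_pos (by omega)
  obtain ⟨w, c, hw, hwc, -⟩ := exists_wave_of_card_le
    (fun x => if h : x ∈ Finset.Icc 1 ((k + 5).choose 5) then χ ⟨x, h⟩ else 0) 2 k 1
    Finset.univ (by simp) (by simp)
  simp only [show k + 2 * 2 + 1 = k + 5 by ring, show 2 * 2 + 1 = 5 by norm_num] at hwc
  have hmem : ∀ i : Fin (k + 1), w i ∈ Finset.Icc 1 ((k + 5).choose 5) := fun i => by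
    have := hwc i i.2
    rw [Finset.mem_Icc]; omega
  refine ⟨fun i => ⟨w i, hmem i⟩, ⟨fun i => ?_, ?_, fun i hi => ?_⟩, c, fun i => ?_⟩
  · have := hwc i i.2; simp only; omega
  · intro i j hij
    exact hw.lt_of_lt hij j.2
  · have := hw.convex i hi
    simp only; omega
  · have := (hwc i i.2).2.2
    rwa [dif_pos (hmem i)] at this

/-! ### Counting functions that avoid prescribed patterns -/

/-- If the sets `S i` are pairwise disjoint with at most two elements, then a random function
`f : ι → A` agrees with `p i` on `S i` with probability at least `1 / (card A) ^ 2`, independently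
for all `i`; this bounds the number of functions which never do. -/
lemma card_avoiding_mul_le {ι A κ : Type*} [Fintype ι] [DecidableEq ι] [Fintype A] [DecidableEq A]
    [Nonempty A] [DecidableEq κ] (I : Finset κ) (S : κ → Finset ι) (p : κ → ι → A)
    (F : Finset (ι → A)) (hF : ∀ f ∈ F, ∀ i ∈ I, ∃ x ∈ S i, f x ≠ p i x)
    (hS : ∀ i ∈ I, (S i).card ≤ 2)
    (hdisj : ∀ i ∈ I, ∀ j ∈ I, i ≠ j → Disjoint (S i) (S j)) :
    F.card * (Fintype.card A ^ 2) ^ I.card ≤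
      Fintype.card (ι → A) * (Fintype.card A ^ 2 - 1) ^ I.card := by
  refine le_trans (Nat.mul_le_mul_right _ (Finset.card_le_card
    (t := Finset.univ.filter (fun f : ι → A => ∀ i ∈ I, ∃ x ∈ S i, f x ≠ p i x))
    fun f hf => Finset.mem_filter.2 ⟨Finset.mem_univ _, hF f hf⟩)) ?_
  clear hF
  induction I using Finset.induction_on with
  | empty => simp
  | insert i I hi ih =>
    have ih := ih (fun j hj => hS j (Finset.mem_insert_of_mem hj))
      (fun j hj l hl => hdisj j (Finset.mem_insert_of_mem hj) l (Finset.mem_insert_of_mem hl))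
    set X := Finset.univ.filter (fun f : ι → A => ∀ j ∈ I, ∃ x ∈ S j, f x ≠ p j x) with hX
    set Y := X.filter (fun f => ∀ x ∈ S i, f x = p i x) with hY
    have ha : 0 < Fintype.card A := Fintype.card_pos
    -- Overwriting `f` by `p i` on `S i` maps `X` to `Y`; `f` is recovered from its values on `S i`.
    have hXY : X.card ≤ Y.card * Fintype.card A ^ 2 := by
      have h1 : X.card ≤ (Y ×ˢ (Finset.univ : Finset (S i → A))).card := by
        refine Finset.card_le_card_of_injOn
          (fun f => ((fun x => if x ∈ S i then p i x else f x), fun x => f x)) ?_ ?_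
        · intro f hf
          simp only [Finset.coe_product, Finset.coe_univ, Set.mem_prod, Finset.mem_coe,
            Set.mem_univ, and_true]
          rw [hY, Finset.mem_filter, hX, Finset.mem_filter]
          refine ⟨⟨Finset.mem_univ _, fun j hj => ?_⟩, fun x hx => by simp [hx]⟩
          obtain ⟨x, hx, hne⟩ := (Finset.mem_filter.1 (Finset.mem_coe.1 hf)).2 j hj
          have hd := hdisj i (Finset.mem_insert_self _ _) j (Finset.mem_insert_of_mem hj)
            (by rintro rfl; exact hi hj)
          refine ⟨x, hx, ?_⟩
          simpa only [if_neg (Finset.disjoint_right.1 hd hx)] using hne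
        · intro f _ g _ hfg
          simp only [Prod.mk.injEq] at hfg
          funext x
          by_cases hx : x ∈ S i
          · exact congrFun hfg.2 ⟨x, hx⟩
          · simpa [hx] using congrFun hfg.1 x
      rw [Finset.card_product, Finset.card_univ, Fintype.card_fun, Fintype.card_coe] at h1
      exact h1.trans (Nat.mul_le_mul_left _
        (Nat.pow_le_pow_right ha (hS i (Finset.mem_insert_self _ _))))
    have hZ : (Finset.univ.filter
        (fun f : ι → A => ∀ j ∈ insert i I, ∃ x ∈ S j, f x ≠ p j x)).card + Y.card ≤ X.card := by
      rw [← Finset.card_union_of_disjoint]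
      · refine Finset.card_le_card (Finset.union_subset (fun f hf => ?_) (Finset.filter_subset _ _))
        rw [hX]
        simp only [Finset.mem_filter, Finset.mem_univ, true_and] at hf ⊢
        exact fun j hj => hf j (Finset.mem_insert_of_mem hj)
      · rw [Finset.disjoint_left]
        intro f hf hfY
        simp only [Finset.mem_filter, Finset.mem_univ, true_and] at hf
        obtain ⟨x, hx, hne⟩ := hf i (Finset.mem_insert_self _ _)
        exact hne ((Finset.mem_filter.1 hfY).2 x hx)
    set Z := (Finset.univ.filter
        (fun f : ι → A => ∀ j ∈ insert i I, ∃ x ∈ S j, f x ≠ p j x)).card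
    have hstep : Z * Fintype.card A ^ 2 ≤ X.card * (Fintype.card A ^ 2 - 1) := by
      obtain ⟨b, hb⟩ : ∃ b, Fintype.card A ^ 2 = b + 1 :=
        ⟨Fintype.card A ^ 2 - 1, by have : 0 < Fintype.card A ^ 2 := by positivity
                                    omega⟩
      rw [hb] at hXY ⊢
      simp only [Nat.add_sub_cancel]
      nlinarith
    rw [Finset.card_insert_of_notMem hi, pow_succ (Fintype.card A ^ 2),
      pow_succ (Fintype.card A ^ 2 - 1)]
    calc Z * ((Fintype.card A ^ 2) ^ I.card * Fintype.card A ^ 2)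
        = (Z * Fintype.card A ^ 2) * (Fintype.card A ^ 2) ^ I.card := by ring
      _ ≤ (X.card * (Fintype.card A ^ 2 - 1)) * (Fintype.card A ^ 2) ^ I.card :=
          Nat.mul_le_mul_right _ hstep
      _ = (X.card * (Fintype.card A ^ 2) ^ I.card) * (Fintype.card A ^ 2 - 1) := by ring
      _ ≤ (Fintype.card (ι → A) * (Fintype.card A ^ 2 - 1) ^ I.card) * (Fintype.card A ^ 2 - 1) :=
          Nat.mul_le_mul_right _ ih
      _ = _ := by ring

/-! ### Tracks and their codes -/

/-- A wave with `400 h + 1` terms below `h ^ 2 B` whose differences are large compared with the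
block length `B`, but whose growth over `200` steps is less than `h B`. -/
structure IsTrack (h B : ℕ) (u : ℕ → ℕ) : Prop where
  wave : IsWave (400 * h + 1) u
  lt : ∀ i ≤ 400 * h, u i < h ^ 2 * B
  gap : ∀ i < 400 * h, u i + 36 * B ≤ u (i + 1)
  lag : ∀ j < 2 * h, u (200 * (j + 1)) - u (200 * j) < h * B

/-- The number of whole blocks of length `B` in the `j`-th group of `200` steps of `u`. -/
def blockLag (B : ℕ) (u : ℕ → ℕ) (j : ℕ) : ℕ := (u (200 * (j + 1)) - u (200 * j)) / B

/-- A coarse description of the terms of `u` with index a multiple of `200`: the block of the first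
one, the numbers `blockLag B u j` (as the set of all `blockLag B u j + j`, which determines a
monotone sequence), and the rounding errors in adding them up. -/
def trackCode (h B : ℕ) (u : ℕ → ℕ) : ℕ × Finset ℕ × Finset ℕ :=
  (u 0 / B, (Finset.univ : Finset (Fin (2 * h))).image (fun j : Fin (2 * h) => blockLag B u j + j),
    (Finset.range (2 * h)).filter
      (fun j => u (200 * (j + 1)) / B ≠ u (200 * j) / B + blockLag B u j))

namespace IsTrack

variable {h B : ℕ} {u v : ℕ → ℕ}

lemma blockLag_mono (hu : IsTrack h B u) {i j : ℕ} (hij : i ≤ j) (hj : j < 2 * h) :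
    blockLag B u i ≤ blockLag B u j := by
  refine Nat.div_le_div_right ?_
  have := hu.wave.lag_mono (i := 200 * i) (j := 200 * j) 200 (by omega) (by omega)
  rw [show 200 * (i + 1) = 200 * i + 200 by ring, show 200 * (j + 1) = 200 * j + 200 by ring]
  omega

lemma blockLag_lt (hu : IsTrack h B u) (hB : 0 < B) {j : ℕ} (hj : j < 2 * h) :
    blockLag B u j < h :=
  (Nat.div_lt_iff_lt_mul hB).2 (hu.lag j hj)

/-- Adding up the `blockLag`s gives the blocks of the terms, up to a rounding error of `0` or `1`
in each step. -/
lemma block_succ (hu : IsTrack h B u) (hB : 0 < B) {j : ℕ} (hj : j < 2 * h) :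
    u (200 * (j + 1)) / B = u (200 * j) / B + blockLag B u j ∨
      u (200 * (j + 1)) / B = u (200 * j) / B + blockLag B u j + 1 := by
  have hle : u (200 * j) ≤ u (200 * (j + 1)) := hu.wave.le_of_le (by omega) (by omega)
  obtain ⟨d, hd⟩ := Nat.exists_eq_add_of_le hle
  have hlag : blockLag B u j = d / B := by rw [blockLag, hd, Nat.add_sub_cancel_left]
  rw [hlag, hd, Nat.add_div hB]
  split_ifs <;> simp

lemma trackCode_mem (hu : IsTrack h B u) (hB : 0 < B) :
    trackCode h B u ∈ Finset.range (h ^ 2) ×ˢ (Finset.range (3 * h)).powerset ×ˢ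
      (Finset.range (2 * h)).powerset := by
  simp only [trackCode, Finset.mem_product, Finset.mem_range, Finset.mem_powerset]
  refine ⟨(Nat.div_lt_iff_lt_mul hB).2 (hu.lt 0 (by omega)), ?_, Finset.filter_subset _ _⟩
  intro x hx
  obtain ⟨j, -, rfl⟩ := Finset.mem_image.1 hx
  have := hu.blockLag_lt hB j.2
  rw [Finset.mem_range]; omega

lemma blockLag_eq (hu : IsTrack h B u) (hv : IsTrack h B v)
    (huv : trackCode h B u = trackCode h B v) {j : ℕ} (hj : j < 2 * h) :
    blockLag B u j = blockLag B v j := by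
  have key : ∀ {u : ℕ → ℕ}, IsTrack h B u →
      StrictMono (fun j : Fin (2 * h) => blockLag B u j + (j : ℕ)) := by
    intro u hu i j hij
    have := hu.blockLag_mono (i := i) (j := j) (le_of_lt hij) j.2
    have : (i : ℕ) < j := hij
    dsimp only; omega
  have h1 : Set.range (fun j : Fin (2 * h) => blockLag B u j + (j : ℕ)) =
      Set.range (fun j : Fin (2 * h) => blockLag B v j + (j : ℕ)) := by
    have h2 := congrArg (fun c => (c.2.1 : Set ℕ)) huv
    simpa [trackCode] using h2
  have h3 := congrFun (((key hu).range_inj (key hv)).1 h1) ⟨j, hj⟩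
  simpa using h3

/-- Tracks with the same code have every `200`th term in the same block. -/
lemma block_eq (hu : IsTrack h B u) (hv : IsTrack h B v) (hB : 0 < B)
    (huv : trackCode h B u = trackCode h B v) {j : ℕ} (hj : j ≤ 2 * h) :
    u (200 * j) / B = v (200 * j) / B := by
  induction j with
  | zero => exact congrArg Prod.fst huv
  | succ j ih =>
    have hj' : j < 2 * h := hj
    have ih := ih hj'.le
    have h1 := hu.blockLag_eq hv huv hj'
    have h2 := congrArg (fun c => j ∈ c.2.2) huv
    simp only [trackCode, Finset.mem_filter, Finset.mem_range, hj', true_and, eq_iff_iff] at h2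
    rcases hu.block_succ hB hj' with h3 | h3 <;> rcases hv.block_succ hB hj' with h4 | h4 <;> omega

/-- Where `blockLag` is locally constant, the code determines all terms of the track up to an error
of two blocks: by convexity each group of `200` steps lies between the chord of the previous group
and its own chord. -/
lemma close (hu : IsTrack h B u) (hv : IsTrack h B v) (hB : 0 < B)
    (huv : trackCode h B u = trackCode h B v) {j i : ℕ} (hj : j + 1 < 2 * h)
    (hgood : blockLag B u (j + 1) = blockLag B u j) (hi : i < 200) :
    u (200 * (j + 1) + i) ≤ v (200 * (j + 1) + i) + 2 * B := by
  have e1 : 200 * (j + 1) + 200 = 200 * (j + 1 + 1) := by ring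
  have hu2 := hu.wave.le_chord (a := 200 * (j + 1)) hi (by omega)
  have hv1 := hv.wave.chord_le (b := 200 * j) (a := 200 * (j + 1)) (by ring) hi (by omega)
  rw [e1] at hu2
  have hpu := hu.block_eq hv hB huv (j := j + 1) (by omega)
  have hqv : blockLag B v j = blockLag B u (j + 1) := by
    rw [hgood, hu.blockLag_eq hv huv (by omega)]
  have mu := hu.wave.le_of_le (i := 200 * (j + 1)) (j := 200 * (j + 1 + 1)) (by omega) (by omega)
  have mv := hv.wave.le_of_le (i := 200 * j) (j := 200 * (j + 1)) (by omega) (by omega)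
  have a1 := Nat.lt_div_mul_add (a := u (200 * (j + 1))) hB
  have a2 := Nat.div_mul_le_self (v (200 * (j + 1))) B
  have a3 := Nat.lt_div_mul_add (a := u (200 * (j + 1 + 1)) - u (200 * (j + 1))) hB
  have a4 := Nat.div_mul_le_self (v (200 * (j + 1)) - v (200 * j)) B
  change blockLag B v j * B ≤ _ at a4
  change _ < blockLag B u (j + 1) * B + B at a3
  rw [hqv] at a4
  rw [hpu] at a1
  have hi' : (i : ℤ) < 200 := by exact_mod_cast hi
  have hi0 : (0 : ℤ) ≤ i := by positivity
  zify [mu, mv] at a1 a2 a3 a4 ⊢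
  push_cast at hu2 hv1
  have b1 := mul_le_mul_of_nonneg_left a3.le hi0
  have b2 := mul_le_mul_of_nonneg_left a4 hi0
  have b3 : (i : ℤ) * B ≤ 200 * B := mul_le_mul_of_nonneg_right hi'.le (by positivity)
  nlinarith

/-- `blockLag` is constant from `j` to `j + 1` for at least `h` of the `2 h - 1` indices `j`, since
it increases by less than `h` altogether. -/
lemma card_good (hu : IsTrack h B u) (hh : 0 < h) (hB : 0 < B) :
    h ≤ ((Finset.range (2 * h - 1)).filter
      (fun j => blockLag B u (j + 1) = blockLag B u j)).card := by
  have key : ∀ n, n < 2 * h → n ≤ ((Finset.range n).filter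
      (fun j => blockLag B u (j + 1) = blockLag B u j)).card + blockLag B u n := by
    intro n
    induction n with
    | zero => simp
    | succ n ih =>
      intro hn
      have h1 := ih (by omega)
      have h2 := hu.blockLag_mono (i := n) (j := n + 1) (by omega) hn
      rw [Finset.range_add_one, Finset.filter_insert]
      split_ifs with hq
      · rw [Finset.card_insert_of_notMem (by simp)]; omega
      · omega
  have h1 := key (2 * h - 1) (by omega)
  have h2 := hu.blockLag_lt hB (j := 2 * h - 1) (by omega)
  omega

lemma add_mul_le (hu : IsTrack h B u) (i t : ℕ) (hit : i + t ≤ 400 * h) :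
    u i + 36 * B * t ≤ u (i + t) := by
  induction t with
  | zero => simp
  | succ t ih =>
    have h1 := ih (by omega)
    have h2 := hu.gap (i + t) (by omega)
    rw [show i + (t + 1) = i + t + 1 by ring]
    linarith

lemma block_add_le (hu : IsTrack h B u) (hB : 0 < B) {i t : ℕ} (hit : i + t ≤ 400 * h) :
    u i / B + 36 * t ≤ u (i + t) / B := by
  rw [Nat.le_div_iff_mul_le hB]
  have h1 := hu.add_mul_le i t hit
  have h2 := Nat.div_mul_le_self (u i) B
  nlinarith

end IsTrack

/-! ### The random block colouring -/

/-- The colour missing from the `j`-th of the `18` blocks of a superblock. A superblock is described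
by a colour `a.1`, missing from all blocks outside the first third (if `a.2`) or the last third
(otherwise); in that third, all colours are missing in turn. -/
def missing {r : ℕ} (a : Fin (r + 1) × Bool) (j : ℕ) : Fin (r + 1) :=
  if a.2 then (if j < 6 then Fin.ofNat (r + 1) j else a.1)
  else (if 12 ≤ j then Fin.ofNat (r + 1) (j - 12) else a.1)

lemma exists_missing_eq {r : ℕ} (hr : r < 6) (a : Fin (r + 1) × Bool) (c : Fin (r + 1)) :
    ∃ j < 18, missing a j = c := by
  have hc := c.2
  rcases a with ⟨e, _ | _⟩
  · exact ⟨12 + c, by omega, by simp [missing]⟩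
  · exact ⟨c, by omega, by simp [missing]; omega⟩

/-- The colouring made of blocks of length `B`, each coloured by a copy of `η` in all colours but
one; the missing colours are prescribed by the description `f` of the superblocks. -/
def blockColoring {r : ℕ} (B : ℕ) (η : ℕ → Fin r) (f : ℕ → Fin (r + 1) × Bool) (x : ℕ) :
    Fin (r + 1) :=
  (missing (f (x / B / 18)) (x / B % 18)).succAbove (η (x % B))

section

variable {r B l K N : ℕ} {η : ℕ → Fin r} {f : ℕ → Fin (r + 1) × Bool} {c : Fin (r + 1)}
  {w : ℕ → ℕ}

lemma missing_ne {x : ℕ} (hx : blockColoring B η f x = c) :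
    missing (f (x / B / 18)) (x / B % 18) ≠ c := by
  rw [← hx]
  exact (Fin.succAbove_ne _ _).symm

/-- A monochromatic wave stays in one block for fewer than `l` terms if `η` avoids `l`-term waves. -/
lemma block_lt_block_add (hη : Avoids l B η) (hB : 0 < B) (hw : IsWave K w)
    (hc : ∀ i < K, blockColoring B η f (w i) = c) {i : ℕ} (hi : i + l < K) :
    w i / B < w (i + l) / B := by
  by_contra hcon
  have hsame : ∀ j ≤ l, w (i + j) / B = w i / B := fun j hj => by
    have h1 := Nat.div_le_div_right (c := B) (hw.le_of_le (i := i) (j := i + j) (by omega) (by omega))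
    have h2 := Nat.div_le_div_right (c := B)
      (hw.le_of_le (i := i + j) (j := i + l) (by omega) (by omega))
    omega
  have hdecomp : ∀ j ≤ l, w (i + j) = B * (w i / B) + w (i + j) % B := fun j hj => by
    rw [← hsame j hj, Nat.div_add_mod]
  have hwave : IsWave l (fun j => w (i + j) % B) := by
    constructor
    · intro j hj
      have h1 := hw.lt (i + j) (by omega)
      have h2 := hdecomp j (by omega)
      have h3 := hdecomp (j + 1) (by omega)
      rw [show i + j + 1 = i + (j + 1) by ring] at h1
      omega
    · intro j hj
      have h1 := hw.convex (i + j) (by omega)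
      have h2 := hdecomp j (by omega)
      have h3 := hdecomp (j + 1) (by omega)
      have h4 := hdecomp (j + 2) (by omega)
      rw [show i + j + 1 = i + (j + 1) by ring, show i + j + 2 = i + (j + 2) by ring] at h1
      omega
  obtain ⟨j, hj, hne⟩ := hη _ hwave (fun j _ => Nat.mod_lt _ hB) (η (w i % B))
  apply hne
  have h1 := hc (i + j) (by omega)
  have h2 := hc i (by omega)
  rw [← h2, blockColoring, blockColoring, hsame j hj.le] at h1
  exact Fin.succAbove_right_injective h1

/-- A monochromatic wave soon has differences larger than a block: otherwise it meets every block
on its way, but some block in every superblock misses its colour. -/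
lemma exists_lt_diff (hr : r < 6) (hη : Avoids l B η) (hB : 0 < B) (hw : IsWave K w)
    (hc : ∀ i < K, blockColoring B η f (w i) = c) (hK : 36 * l < K) :
    ∃ i < 36 * l, w i + B < w (i + 1) := by
  by_contra! hcon
  have hjump : ∀ j ≤ 36, w 0 / B + j ≤ w (l * j) / B := by
    intro j
    induction j with
    | zero => simp
    | succ j ih =>
      intro hj
      have h1 := ih (by omega)
      have h2 := block_lt_block_add (i := l * j) hη hB hw hc (by nlinarith)
      rw [show l * (j + 1) = l * j + l by ring]
      omega
  have hend := hjump 36 le_rfl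
  rw [mul_comm] at hend
  have hsurj : ∀ n ≤ 36 * l, ∀ X, w 0 / B ≤ X → X ≤ w n / B → ∃ i ≤ n, w i / B = X := by
    intro n
    induction n with
    | zero => intro _ X h1 h2; exact ⟨0, le_rfl, by omega⟩
    | succ n ih =>
      intro hn X h1 h2
      by_cases hX : X ≤ w n / B
      · obtain ⟨i, hi, hiX⟩ := ih (by omega) X h1 hX
        exact ⟨i, by omega, hiX⟩
      · refine ⟨n + 1, le_rfl, ?_⟩
        have h3 := Nat.div_le_div_right (c := B) (hcon n (by omega))
        rw [Nat.add_div_right _ hB] at h3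
        omega
  obtain ⟨j, hj, hmiss⟩ := exists_missing_eq hr (f (w 0 / B / 18 + 1)) c
  obtain ⟨i, hi, hiX⟩ := hsurj (36 * l) le_rfl (18 * (w 0 / B / 18 + 1) + j) (by omega) (by omega)
  refine missing_ne (hc i (by omega)) ?_
  rw [hiX, show (18 * (w 0 / B / 18 + 1) + j) / 18 = w 0 / B / 18 + 1 by omega,
    show (18 * (w 0 / B / 18 + 1) + j) % 18 = j by omega]
  exact hmiss

end

/-- A monochromatic `57600 h`-term wave below `h ^ 2 B` contains a track: drop the first `14400 h`
terms, after which the differences exceed `B`, and take every `36`th of the following terms, which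
makes consecutive ones at least two superblocks apart. -/
lemma exists_isTrack {r B h : ℕ} {η : ℕ → Fin r} {f : ℕ → Fin (r + 1) × Bool} {c : Fin (r + 1)}
    {w : ℕ → ℕ} (hr : r < 6) (hη : Avoids (400 * h) B η) (hB : 0 < B) (hh : 0 < h)
    (hw : IsWave (57600 * h) w) (hN : ∀ i < 57600 * h, w i < h ^ 2 * B)
    (hc : ∀ i < 57600 * h, blockColoring B η f (w i) = c) :
    ∃ u, IsTrack h B u ∧ ∀ i ≤ 400 * h, blockColoring B η f (u i) = c := by
  obtain ⟨i₀, hi₀, hlarge⟩ := exists_lt_diff hr hη hB hw hc (by omega)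
  refine ⟨fun i => w (14400 * h + 36 * i), ⟨hw.subsample (by omega) (by omega),
    fun i hi => hN _ (by omega), fun i hi => ?_, fun j hj => ?_⟩, fun i hi => hc _ (by omega)⟩
  · have h1 := hw.mul_diff_le (i := i₀) (j := 14400 * h + 36 * i) 36 (by omega) (by omega)
    show w (14400 * h + 36 * i) + 36 * B ≤ w (14400 * h + 36 * (i + 1))
    rw [show 14400 * h + 36 * (i + 1) = 14400 * h + 36 * i + 36 by ring]
    omega
  -- Half of the terms come after the index `28800 h`, so the difference there is small.
  · have h1 := hw.mul_diff_le (i := 28800 * h) (j := 28800 * h) (7200 * h) le_rfl (by omega)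
    have h2 := hw.le_mul_diff (l := 28800 * h) (j := 14400 * h + 36 * (200 * j)) 7200
      (by omega) (by omega)
    have h3 := hN (28800 * h + 7200 * h) (by omega)
    show w (14400 * h + 36 * (200 * (j + 1))) - w (14400 * h + 36 * (200 * j)) < h * B
    rw [show 14400 * h + 36 * (200 * (j + 1)) = 14400 * h + 36 * (200 * j) + 7200 by ring]
    set d : ℤ := (w (28800 * h + 1) : ℤ) - w (28800 * h)
    push_cast at h1 h2
    have h4 : (h : ℤ) * (7200 * d) < h * (h * B) := by
      zify at h3
      nlinarith [Int.natCast_nonneg (w (28800 * h))]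
    have h5 := lt_of_mul_lt_mul_left h4 (by positivity)
    have h6 : (0 : ℤ) < h * B := by positivity
    zify at h6 ⊢
    omega

/-- A description of the superblocks for which the colour `c` is missing from all blocks
`z, …, z + 4`. -/
def badPattern {r : ℕ} (c : Fin (r + 1)) (z y : ℕ) : Fin (r + 1) × Bool :=
  if y = z / 18 then (c, decide (6 ≤ z % 18)) else (c, false)

/-- Five consecutive blocks never meet both the first and the last third of a superblock, which
leaves a third for the cycle through all colours; the same holds if they straddle two superblocks. -/
lemma missing_badPattern {r : ℕ} (c : Fin (r + 1)) {z X : ℕ} (h1 : z ≤ X) (h2 : X ≤ z + 4) :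
    missing (badPattern c z (X / 18)) (X % 18) = c := by
  unfold badPattern missing
  by_cases hX : X / 18 = z / 18
  · by_cases hz : 6 ≤ z % 18
    · simp [hX, hz, show ¬ X % 18 < 6 by omega]
    · simp [hX, hz, show ¬ 12 ≤ X % 18 by omega]
  · simp [hX, show ¬ 12 ≤ X % 18 by omega]

/-! ### Adding a colour by the union bound -/

/-- For an alphabet of at most `6` letters, `200` independent events of probability at least
`1 / a ^ 2` all fail with probability below `2 ^ (-8)`. -/
lemma pow_two_mul_lt_pow {a : ℕ} (ha : 1 ≤ a) (ha6 : a ≤ 6) :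
    (a ^ 2 - 1) ^ 200 * 2 ^ 8 < (a ^ 2) ^ 200 := by
  interval_cases a <;> norm_num

lemma three_mul_sq_lt (h : ℕ) (hh : 0 < h) : 3 * h ^ 2 < 2 ^ (3 * h) := by
  induction h, hh using Nat.le_induction with
  | base => norm_num
  | succ h hh ih =>
    rw [show 3 * (h + 1) = 3 * h + 3 by ring, pow_add]
    have : 0 < h := hh
    nlinarith

/-- Few of the block colourings have monochromatic tracks with a given code: a track `v` with that
code predicts the others, and each prediction makes it unlikely that the colour is present. -/
lemma card_fiber_mul_le {r B h : ℕ} {η : ℕ → Fin r} (hB : 0 < B) (hh : 0 < h)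
    (c : Fin (r + 1)) (F : Finset (Fin (h ^ 2 + 1) → Fin (r + 1) × Bool))
    (u : (Fin (h ^ 2 + 1) → Fin (r + 1) × Bool) → ℕ → ℕ) (hu : ∀ f ∈ F, IsTrack h B (u f))
    (hcode : ∀ f ∈ F, ∀ g ∈ F, trackCode h B (u f) = trackCode h B (u g))
    (hc : ∀ f ∈ F, ∀ i ≤ 400 * h,
      blockColoring B η (fun y => f (Fin.ofNat (h ^ 2 + 1) y)) (u f i) = c) :
    F.card * ((2 * (r + 1)) ^ 2) ^ (200 * h) ≤
      Fintype.card (Fin (h ^ 2 + 1) → Fin (r + 1) × Bool) *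
        ((2 * (r + 1)) ^ 2 - 1) ^ (200 * h) := by
  rcases F.eq_empty_or_nonempty with rfl | ⟨g, hg⟩
  · simp
  have hv := hu g hg
  set v := u g with hvdef
  obtain ⟨G, hGsub, hGcard⟩ := Finset.exists_subset_card_eq (hv.card_good hh hB)
  have hG : ∀ j ∈ G, j + 1 < 2 * h ∧ blockLag B v (j + 1) = blockLag B v j := fun j hj => by
    have := Finset.mem_filter.1 (hGsub hj)
    rw [Finset.mem_range] at this
    exact ⟨by omega, this.2⟩
  -- At step `t q` all tracks in the family are in the blocks `z q, …, z q + 4`, hence in one of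
  -- the two superblocks in `S q`, and if these are described by `p q`, the colour `c` is missing.
  let I := G ×ˢ Finset.range 200
  let t : ℕ × ℕ → ℕ := fun q => 200 * (q.1 + 1) + q.2
  let z : ℕ × ℕ → ℕ := fun q => v (t q) / B - 2
  let S : ℕ × ℕ → Finset (Fin (h ^ 2 + 1)) := fun q =>
    {Fin.ofNat _ (z q / 18), Fin.ofNat _ (z q / 18 + 1)}
  let p : ℕ × ℕ → Fin (h ^ 2 + 1) → Fin (r + 1) × Bool := fun q x => badPattern c (z q) x
  have hI : ∀ q ∈ I, q.1 + 1 < 2 * h ∧ blockLag B v (q.1 + 1) = blockLag B v q.1 ∧ q.2 < 200 ∧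
      t q < 400 * h ∧ z q / 18 + 1 < h ^ 2 + 1 := fun q hq => by
    obtain ⟨h1, h2⟩ := Finset.mem_product.1 hq
    have h3 := hG _ h1
    rw [Finset.mem_range] at h2
    have ht : t q < 400 * h := by simp only [t]; omega
    have h4 : v (t q) / B < h ^ 2 := (Nat.div_lt_iff_lt_mul hB).2 (hv.lt _ ht.le)
    exact ⟨h3.1, h3.2, h2, ht, by simp only [z]; generalize v (t q) / B = X at *; omega⟩
  have hval : ∀ y, y < h ^ 2 + 1 → ((Fin.ofNat (h ^ 2 + 1) y : Fin (h ^ 2 + 1)) : ℕ) = y :=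
    fun y hy => by simp [Fin.ofNat, Nat.mod_eq_of_lt hy]
  have hfar : ∀ q ∈ I, ∀ q' ∈ I, t q < t q' → z q / 18 + 2 ≤ z q' / 18 := by
    intro q hq q' hq' hlt
    have h1 := hv.block_add_le hB (i := t q) (t := t q' - t q) (by have := hI q' hq'; omega)
    have h2 := hv.block_add_le hB (i := 0) (t := t q) (by have := hI q hq; omega)
    rw [show t q + (t q' - t q) = t q' by omega] at h1
    rw [zero_add] at h2
    have h3 : 200 ≤ t q := by simp only [t]; omega
    -- In particular the subtraction in the definition of `z` does not truncate.
    have h4 : 36 * 200 ≤ v (t q) / B :=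
      (by omega : 36 * 200 ≤ 36 * t q).trans ((Nat.le_add_left _ _).trans h2)
    simp only [z]
    generalize v (t q) / B = X at *
    generalize v (t q') / B = X' at *
    omega
  have hdisj' : ∀ q ∈ I, ∀ q' ∈ I, t q < t q' → Disjoint (S q) (S q') := by
    intro q hq q' hq' hlt
    have h1 := hfar q hq q' hq' hlt
    have h2 := hI q hq
    have h3 := hI q' hq'
    rw [Finset.disjoint_left]
    intro x hx hx'
    simp only [S, Finset.mem_insert, Finset.mem_singleton, Fin.ext_iff] at hx hx'
    rw [hval _ (by omega), hval _ (by omega)] at hx hx'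
    omega
  have hcardI : I.card = 200 * h := by
    rw [Finset.card_product, hGcard, Finset.card_range, mul_comm]
  rw [← hcardI, show 2 * (r + 1) = Fintype.card (Fin (r + 1) × Bool) by simp [mul_comm]]
  refine card_avoiding_mul_le I S p F ?_ (fun q _ => Finset.card_le_two) (by
    intro q hq q' hq' hne
    rcases lt_trichotomy (t q) (t q') with hlt | heq | hlt
    · exact hdisj' q hq q' hq' hlt
    · exfalso
      apply hne
      have h2 := hI q hq
      have h3 := hI q' hq'
      simp only [t] at heq
      exact Prod.ext (by omega) (by omega)
    · exact (hdisj' q' hq' q hq hlt).symm)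
  intro f hf q hq
  by_contra! hcon
  obtain ⟨hq1, hq2, hq3, hq4, hq5⟩ := hI q hq
  have hlag : blockLag B (u f) (q.1 + 1) = blockLag B (u f) q.1 := by
    rw [(hu f hf).blockLag_eq hv (hcode f hf g hg) hq1,
      (hu f hf).blockLag_eq hv (hcode f hf g hg) (by omega), hq2]
  have c1 : u f (t q) ≤ v (t q) + 2 * B :=
    (hu f hf).close hv hB (hcode f hf g hg) hq1 hlag hq3
  have c2 : v (t q) ≤ u f (t q) + 2 * B := hv.close (hu f hf) hB (hcode g hg f hf) hq1 hq2 hq3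
  have d1 : u f (t q) / B ≤ v (t q) / B + 2 := by
    rw [← Nat.add_mul_div_right _ _ hB]; exact Nat.div_le_div_right c1
  have d2 : v (t q) / B ≤ u f (t q) / B + 2 := by
    rw [← Nat.add_mul_div_right _ _ hB]; exact Nat.div_le_div_right c2
  have hz : 2 ≤ v (t q) / B := by
    have h2 := hv.block_add_le hB (i := 0) (t := t q) (by omega)
    rw [zero_add] at h2
    have h3 : 200 ≤ t q := by simp only [t]; omega
    exact (by omega : 2 ≤ 36 * t q).trans ((Nat.le_add_left _ _).trans h2)
  have z1 : z q ≤ u f (t q) / B := by simp only [z]; omega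
  have z2 : u f (t q) / B ≤ z q + 4 := by simp only [z]; omega
  refine missing_ne (hc f hf (t q) hq4.le) ?_
  have hy : u f (t q) / B / 18 = z q / 18 ∨ u f (t q) / B / 18 = z q / 18 + 1 := by omega
  have hfp : f (Fin.ofNat (h ^ 2 + 1) (u f (t q) / B / 18)) =
      badPattern c (z q) (u f (t q) / B / 18) := by
    rcases hy with hy | hy <;> rw [hy, hcon _ (by simp [S])] <;> simp only [p] <;>
      rw [hval _ (by omega)]
  rw [hfp]
  exact missing_badPattern c z1 z2

/-- Adding a colour: blocks of length `B`, coloured without `400 h`-term waves, can be combined to a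
colouring of an interval that is longer by a factor `h ^ 2` with only slightly longer waves. -/
theorem exists_avoids_succ {r B h : ℕ} (hr : r + 1 ≤ 3) {η : ℕ → Fin r}
    (hη : Avoids (400 * h) B η) (hB : 0 < B) (hh : 0 < h) :
    ∃ χ : ℕ → Fin (r + 1), Avoids (57600 * h) (h ^ 2 * B) χ := by
  by_contra! hcon
  let Φ := Fin (h ^ 2 + 1) → Fin (r + 1) × Bool
  have key : ∀ f : Φ, ∃ (c : Fin (r + 1)) (u : ℕ → ℕ), IsTrack h B u ∧ ∀ i ≤ 400 * h,
      blockColoring B η (fun y => f (Fin.ofNat (h ^ 2 + 1) y)) (u i) = c := by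
    intro f
    have h1 := hcon (blockColoring B η (fun y => f (Fin.ofNat (h ^ 2 + 1) y)))
    unfold Avoids at h1
    push Not at h1
    obtain ⟨w, hw, hN, c, hc⟩ := h1
    exact ⟨c, exists_isTrack (by omega) hη hB hh hw hN hc⟩
  choose c u hu hc using key
  -- `T` contains all pairs of a colour and a code of a track.
  let T := (Finset.univ : Finset (Fin (r + 1))) ×ˢ Finset.range (h ^ 2) ×ˢ
    (Finset.range (3 * h)).powerset ×ˢ (Finset.range (2 * h)).powerset
  have hT : T.card ≤ 3 * h ^ 2 * 2 ^ (5 * h) := by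
    simp only [T, Finset.card_product, Finset.card_univ, Fintype.card_fin, Finset.card_range,
      Finset.card_powerset]
    rw [← pow_add, show 3 * h + 2 * h = 5 * h by ring, ← mul_assoc]
    gcongr
  set a := (2 * (r + 1)) ^ 2 with ha
  set b := Fintype.card Φ * (a - 1) ^ (200 * h) with hb
  have hapos : 0 < a := by positivity
  have hfib : ∀ e ∈ T, (Finset.univ.filter
      (fun f : Φ => (c f, trackCode h B (u f)) = e)).card ≤ b / a ^ (200 * h) := by
    intro e _
    rw [Nat.le_div_iff_mul_le (by positivity)]
    refine card_fiber_mul_le (η := η) hB hh e.1 _ u (fun f _ => hu f) ?_ ?_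
    · intro f hf g hg
      rw [Finset.mem_filter] at hf hg
      exact congrArg Prod.snd (hf.2.trans hg.2.symm)
    · intro f hf i hi
      rw [Finset.mem_filter] at hf
      rw [hc f i hi]
      exact congrArg Prod.fst hf.2
  have hcount := Finset.card_le_mul_card_image_of_maps_to
    (s := (Finset.univ : Finset Φ)) (t := T) (f := fun f => (c f, trackCode h B (u f)))
    (fun f _ => Finset.mem_product.2 ⟨Finset.mem_univ _, (hu f).trackCode_mem hB⟩) _ hfib
  rw [Finset.card_univ] at hcount
  have hΦ : 0 < Fintype.card Φ := Fintype.card_pos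
  have h1 : a ^ (200 * h) ≤ (a - 1) ^ (200 * h) * T.card := by
    refine Nat.le_of_mul_le_mul_left ?_ hΦ
    calc Fintype.card Φ * a ^ (200 * h)
        ≤ b / a ^ (200 * h) * T.card * a ^ (200 * h) := Nat.mul_le_mul_right _ hcount
      _ = b / a ^ (200 * h) * a ^ (200 * h) * T.card := by ring
      _ ≤ b * T.card := Nat.mul_le_mul_right _ (Nat.div_mul_le_self _ _)
      _ = Fintype.card Φ * ((a - 1) ^ (200 * h) * T.card) := by rw [hb]; ring
  have h2 : T.card < 2 ^ (8 * h) := by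
    calc T.card ≤ 3 * h ^ 2 * 2 ^ (5 * h) := hT
      _ < 2 ^ (3 * h) * 2 ^ (5 * h) :=
          Nat.mul_lt_mul_of_pos_right (three_mul_sq_lt h hh) (by positivity)
      _ = 2 ^ (8 * h) := by rw [← pow_add]; congr 1; ring
  have h3 : (a - 1) ^ (200 * h) * 2 ^ (8 * h) ≤ a ^ (200 * h) := by
    rw [pow_mul, pow_mul, pow_mul a, ← mul_pow]
    exact Nat.pow_le_pow_left
      (pow_two_mul_lt_pow (a := 2 * (r + 1)) (by omega) (by omega)).le h
  have h4 : 0 < (a - 1) ^ (200 * h) := by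
    have : 4 ≤ a := by rw [ha]; nlinarith
    have : 0 < a - 1 := by omega
    positivity
  exact absurd (h1.trans_lt (Nat.mul_lt_mul_of_pos_left h2 h4)) (not_lt.2 h3)

/-! ### Bounds for the three-colour number -/

lemma isLeast_AW {k : ℕ} (hk : 1 ≤ k) : IsLeast {N : ℕ | 0 < N ∧ ForcesWave k 3 N} (AW k 3) := by
  obtain ⟨k, rfl⟩ : ∃ l, k = l + 1 := ⟨k - 1, by omega⟩
  have hne : {N : ℕ | 0 < N ∧ ForcesWave (k + 1) 3 N}.Nonempty :=
    ⟨_, Nat.choose_pos (by omega), forcesWave_choose k⟩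
  exact ⟨Nat.sInf_mem hne, fun N hN => Nat.sInf_le hN⟩

lemma AW_le_choose (k : ℕ) : AW (k + 1) 3 ≤ (k + 5).choose 5 :=
  Nat.sInf_le ⟨Nat.choose_pos (by omega), forcesWave_choose k⟩

lemma ForcesWave.mono {k r M N : ℕ} (h : ForcesWave k r M) (hMN : M ≤ N) : ForcesWave k r N := by
  intro χ
  obtain ⟨w, hw, c, hc⟩ := h (fun x => χ ⟨x, Finset.Icc_subset_Icc_right hMN x.2⟩)
  exact ⟨fun i => ⟨w i, Finset.Icc_subset_Icc_right hMN (w i).2⟩, hw, c, hc⟩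

lemma Avoids.lt_AW {k N : ℕ} (hk : 1 ≤ k) {χ : ℕ → Fin 3} (h : Avoids k N χ) : N < AW k 3 := by
  by_contra! hle
  exact h.not_forcesWave ((isLeast_AW hk).1.2.mono hle)

/-- Two steps of `exists_avoids_succ` starting with a single colour on `h'` points. -/
lemma exists_avoids_three {h h' : ℕ} (hh : 0 < h') (hle : 144 * h' ≤ h) :
    ∃ χ : ℕ → Fin 3, Avoids (57600 * h) (h ^ 2 * h' ^ 3) χ := by
  obtain ⟨χ, hχ⟩ := exists_avoids_succ (r := 1) (B := h') (h := h') (by norm_num)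
    (avoids_of_lt (k := 400 * h') (fun _ => 0) (by omega)) hh hh
  rw [show h' ^ 2 * h' = h' ^ 3 by ring] at hχ
  exact exists_avoids_succ (r := 2) (by norm_num) (hχ.mono (by omega)) (by positivity) (by omega)

lemma pow_five_le_mul_AW {k : ℕ} (hk : 1 ≤ k) : k ^ 5 ≤ 2 ^ 13 * 10 ^ 39 * AW k 3 := by
  have hpos : 0 < AW k 3 := (isLeast_AW hk).1.1
  set h := k / 57600 with hh
  set h' := h / 144 with hh'
  rcases Nat.eq_zero_or_pos h' with h0 | h0
  -- For small `k` the claimed bound is below `1`.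
  · have : k ≤ 8294400 := by omega
    calc k ^ 5 ≤ 8294400 ^ 5 := Nat.pow_le_pow_left this 5
      _ ≤ 2 ^ 13 * 10 ^ 39 * 1 := by norm_num
      _ ≤ _ := Nat.mul_le_mul_left _ hpos
  · obtain ⟨χ, hχ⟩ := exists_avoids_three (h := h) h0 (by omega)
    have hlt := (hχ.mono (l := k) (by omega)).lt_AW hk
    calc k ^ 5 = k ^ 2 * k ^ 3 := by ring
      _ ≤ (115200 * h) ^ 2 * (16588800 * h') ^ 3 := by
          gcongr <;> omega
      _ = 115200 ^ 2 * 16588800 ^ 3 * (h ^ 2 * h' ^ 3) := by ring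
      _ ≤ 2 ^ 13 * 10 ^ 39 * (h ^ 2 * h' ^ 3) := Nat.mul_le_mul_right _ (by norm_num)
      _ ≤ _ := Nat.mul_le_mul_left _ hlt.le

lemma AW_le_poly {k : ℕ} (hk : 1 ≤ k) :
    (AW k 3 : ℝ) ≤ (k : ℝ) * (k + 1) * (k + 2) * (k + 3) * (k + 4) / 120 := by
  obtain ⟨k, rfl⟩ : ∃ l, k = l + 1 := ⟨k - 1, by omega⟩
  refine le_trans (Nat.cast_le.2 (AW_le_choose k)) (le_of_eq ?_)
  have h3 : (((k + 1).ascFactorial 5 : ℕ) : ℝ) = 120 * ((k + 5).choose 5 : ℕ) := by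
    rw [Nat.ascFactorial_eq_factorial_mul_choose]
    norm_num [Nat.factorial]
  rw [eq_div_iff (by norm_num), mul_comm, ← h3]
  simp [Nat.ascFactorial]
  ring

theorem theorem3 :
    (∀ k : ℕ, 1 ≤ k → IsLeast {N : ℕ | 0 < N ∧ ForcesWave k 3 N} (AW k 3)) ∧
    (∀ k : ℕ, 1 ≤ k → (k : ℝ) ^ 5 / (2 ^ 13 * 10 ^ 39) ≤ (AW k 3 : ℝ)) ∧
    (∃ ε : ℕ → ℝ, Tendsto ε atTop (𝓝 0) ∧
      ∀ k : ℕ, 1 ≤ k → (AW k 3 : ℝ) ≤ (k : ℝ) ^ 5 / 120 * (1 + ε k)) ∧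
    (fun k : ℕ => (AW k 3 : ℝ)) =Θ[atTop] (fun k : ℕ => (k : ℝ) ^ 5) := by
  have hlow : ∀ k : ℕ, 1 ≤ k → (k : ℝ) ^ 5 / (2 ^ 13 * 10 ^ 39) ≤ (AW k 3 : ℝ) := fun k hk => by
    rw [div_le_iff₀ (by positivity), mul_comm]
    exact_mod_cast pow_five_le_mul_AW hk
  refine ⟨fun k hk => isLeast_AW hk, hlow, ⟨fun k => (1 + 1 * (k : ℝ)⁻¹) * (1 + 2 * (k : ℝ)⁻¹) *
    (1 + 3 * (k : ℝ)⁻¹) * (1 + 4 * (k : ℝ)⁻¹) - 1, ?_, fun k hk => ?_⟩, ?_, ?_⟩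
  · have h : ∀ c : ℝ, Tendsto (fun k : ℕ => 1 + c * (k : ℝ)⁻¹) atTop (𝓝 1) := fun c => by
      simpa using (tendsto_inv_atTop_nhds_zero_nat (𝕜 := ℝ)).const_mul c |>.const_add 1
    simpa using (((h 1).mul (h 2)).mul (h 3)).mul (h 4) |>.sub_const 1
  · have hk0 : (k : ℝ) ≠ 0 := by positivity
    refine (AW_le_poly hk).trans (le_of_eq ?_)
    field_simp
    ring
  · refine IsBigO.of_bound 1 (eventually_atTop.2 ⟨1, fun k hk => ?_⟩)
    have hk1 : (1 : ℝ) ≤ k := by exact_mod_cast hk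
    rw [Real.norm_of_nonneg (by positivity), Real.norm_of_nonneg (by positivity), one_mul]
    calc (AW k 3 : ℝ) ≤ (k : ℝ) * (k + 1) * (k + 2) * (k + 3) * (k + 4) / 120 := AW_le_poly hk
      _ ≤ (k : ℝ) * (k + k) * (k + 2 * k) * (k + 3 * k) * (k + 4 * k) / 120 := by
          gcongr <;> linarith
      _ = (k : ℝ) ^ 5 := by ring
  · refine IsBigO.of_bound (2 ^ 13 * 10 ^ 39) (eventually_atTop.2 ⟨1, fun k hk => ?_⟩)
    rw [Real.norm_of_nonneg (by positivity), Real.norm_of_nonneg (by positivity), mul_comm,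
      ← div_le_iff₀ (by positivity)]
    exact hlow k hk
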